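/- Let $r\ge 2$, $n=2r$, and let $q\in\mathbf{C}^{\times}$ be not a root of unity, with a fixed square root $q^{1/2}$. Let $\epsilon_1,\dots,\epsilon_r,\delta_1,\dots,\delta_r$ be the usual basis of the dual of the Cartan subalgebra of $osp(n|n)$, with $(\epsilon_i,\epsilon_j)=\delta_{ij}$, $(\delta_\mu,\delta_\nu)=-\delta_{\mu\nu}$, $(\epsilon_i,\delta_\mu)=0$, and simple roots $\epsilon_i-\epsilon_{i+1}$ and $\delta_i-\delta_{i+1}$ $(1\le i<r)$, $\epsilon_{r-1}+\epsilon_r$, and the odd root $\delta_r-\epsilon_1$. Let $U_q[osp(n|n)]$ be the quantum superalgebra over $\mathbf{C}$ generated by $q^{\pm h_i/2},e_i,f_i$, one for each simple root $\alpha_i$, with its Drinfeld--Jimbo relations (including the $q$-Serre and the higher order $q$-Serre relations), and with counit $\varepsilon(e_i)=\varepsilon(f_i)=0$, $\varepsilon(q^{\pm h_i/2})=1$. Write $V(\dot 0|\dot 0)$ for the trivial one-dimensional module, on which each $a$ acts as $\varepsilon(a)$. Let $V$ be a finite-dimensional indecomposable ($\mathbf{Z}_2$-graded) $U_q[osp(n|n)]$-module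 with a composition series of length 3 $$V\supset \bar V(\delta_1+\delta_2)\supset V(\dot 0|\dot 0)\supset (0),$$ where $\bar V(\delta_1+\delta_2)$ is cyclically generated by a maximal vector of weight $\delta_1+\delta_2$ (a nonzero $v$ with $e_iv=0$ and $q^{h_i/2}v=q^{(\alpha_i,\delta_1+\delta_2)/2}v$ for all $i$), and where the top factor $V/\bar V(\delta_1+\delta_2)$ is a trivial one-dimensional module. Then the space of $U_q[osp(n|n)]$-invariant operators on $V$, i.e. of the $A\in\mathrm{End}(V)$ with $aA=Aa$ for all $a\in U_q[osp(n|n)]$, has dimension two. It is spanned by the identity operator $I$ and a nilpotent invariant operator $N$ satisfying $$NV=V(\dot 0|\dot 0),\qquad N^2=0,$$ and $N$ is unique up to scalar multiples: every nilpotent invariant operator on $V$ is a scalar multiple of $N$. -/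

import Mathlib

/-- The index set of an orthogonal basis `ε_1, …, ε_r, δ_1, …, δ_r` of the dual of the Cartan
subalgebra of `osp(n|n)`, `n = 2r` (`inl i` is `ε_{i+1}`, `inr μ` is `δ_{μ+1}`).  The same set
indexes the `s = 2r` simple roots: `inl` gives the simple roots of `o(n)`, `inr` gives those of
`gl(r)` followed by the odd simple root. -/
abbrev OspIndex (r : ℕ) : Type := Fin r ⊕ Fin r

/-- Integral weights of `osp(n|n)`, `n = 2r`, by their coordinates on the `ε_i` and `δ_μ`. -/
abbrev OspWeight (r : ℕ) : Type := OspIndex r → ℤ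

namespace OspWeight

/-- The invariant bilinear form, `(ε_i, ε_j) = δ_{ij}` and `(δ_μ, δ_ν) = -δ_{μν}`. -/
def form {r : ℕ} (x y : OspWeight r) : ℤ :=
  (∑ i : Fin r, x (Sum.inl i) * y (Sum.inl i)) - ∑ μ : Fin r, x (Sum.inr μ) * y (Sum.inr μ)

/-- The simple roots: `ε_i - ε_{i+1}` for `1 ≤ i < r`, `ε_{r-1} + ε_r`, `δ_μ - δ_{μ+1}` for
`1 ≤ μ < r`, and the odd root `δ_r - ε_1`.  (In the code, indices start from `0`.) -/
def simpleRoot {r : ℕ} : OspIndex r → OspWeight r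
  | Sum.inl i, Sum.inl j =>
      if (i : ℕ) + 1 < r then
        (if j = i then 1 else if (j : ℕ) = i + 1 then -1 else 0)
      else (if (j : ℕ) + 2 = r ∨ (j : ℕ) + 1 = r then 1 else 0)
  | Sum.inl _, Sum.inr _ => 0
  | Sum.inr μ, Sum.inl j =>
      if (μ : ℕ) + 1 < r then 0 else (if (j : ℕ) = 0 then -1 else 0)
  | Sum.inr μ, Sum.inr ν =>
      if ν = μ then 1 else if (ν : ℕ) = μ + 1 then -1 else 0

/-- The number `(α_i, α_j)` for simple roots `α_i`, `α_j`. -/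
def cartan {r : ℕ} (i j : OspIndex r) : ℤ := form (simpleRoot i) (simpleRoot j)

/-- The index `s` of the only odd simple root, `α_s = δ_r - ε_1`. -/
def IsOddIndex {r : ℕ} : OspIndex r → Prop
  | Sum.inl _ => False
  | Sum.inr μ => (μ : ℕ) + 1 = r

instance {r : ℕ} : DecidablePred (IsOddIndex (r := r)) := fun i =>
  match i with
  | Sum.inl _ => inferInstanceAs (Decidable False)
  | Sum.inr μ => inferInstanceAs (Decidable ((μ : ℕ) + 1 = r))

/-- The parity of the generators `e_i` and `f_i`. -/
def parity {r : ℕ} (i : OspIndex r) : ZMod 2 := if IsOddIndex i then 1 else 0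

/-- The weight `δ_1 + δ_2`. -/
def theta (r : ℕ) : OspWeight r
  | Sum.inl _ => 0
  | Sum.inr μ => if (μ : ℕ) < 2 then 1 else 0

end OspWeight

/-- Generators of `U_q[osp(n|n)]`: `e_i`, `f_i`, `k_i = q^{h_i/2}` and `k'_i = q^{-h_i/2}`. -/
inductive UqOspGen (r : ℕ) : Type
  | e (i : OspIndex r)
  | f (i : OspIndex r)
  | k (i : OspIndex r)
  | kinv (i : OspIndex r)

namespace UqOsp

open OspWeight

/-- The generators in the free algebra. -/
abbrev gE {r : ℕ} (i : OspIndex r) : FreeAlgebra ℂ (UqOspGen r) := FreeAlgebra.ι ℂ (UqOspGen.e i)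
abbrev gF {r : ℕ} (i : OspIndex r) : FreeAlgebra ℂ (UqOspGen r) := FreeAlgebra.ι ℂ (UqOspGen.f i)
abbrev gK {r : ℕ} (i : OspIndex r) : FreeAlgebra ℂ (UqOspGen r) := FreeAlgebra.ι ℂ (UqOspGen.k i)
abbrev gKinv {r : ℕ} (i : OspIndex r) : FreeAlgebra ℂ (UqOspGen r) :=
  FreeAlgebra.ι ℂ (UqOspGen.kinv i)

/-- The sign `(-1)^{[i][j]}` of the graded commutator `[e_i, f_j]`. -/
def sgn {r : ℕ} (i j : OspIndex r) : ℂ := if IsOddIndex i ∧ IsOddIndex j then -1 else 1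

/-- Defining relations of `U_q[osp(n|n)]`, `n = 2r`, where `q = p ^ 2`, so that
`q^{(α_i, α_j)/2} = p ^ (α_i, α_j)`.  The Cartan matrix is simply laced: for an even simple root
`α_i` and `j ≠ i`, the entry `2 (α_i, α_j) / (α_i, α_i)` is `-1` or `0`, and `q_i = q^{±1}`, so
that the `q`-Serre relations are those written here.  Only one simple root is odd, so no two odd
generators `e_i`, `e_j` with `i ≠ j` occur in `e_comm`.  The last two relations are the
higher order `q`-Serre relations at the odd node. -/
inductive Rel (r : ℕ) (p : ℂ) : FreeAlgebra ℂ (UqOspGen r) → FreeAlgebra ℂ (UqOspGen r) → Prop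
  | k_kinv (i : OspIndex r) : Rel r p (gK i * gKinv i) 1
  | kinv_k (i : OspIndex r) : Rel r p (gKinv i * gK i) 1
  | k_comm (i j : OspIndex r) : Rel r p (gK i * gK j) (gK j * gK i)
  | k_e (i j : OspIndex r) :
      Rel r p (gK i * gE j) (p ^ (cartan i j) • (gE j * gK i))
  | k_f (i j : OspIndex r) :
      Rel r p (gK i * gF j) (p ^ (-cartan i j) • (gF j * gK i))
  | e_f_same (i : OspIndex r) :
      Rel r p (gE i * gF i - sgn i i • (gF i * gE i))
        ((p ^ 2 - (p ^ 2)⁻¹)⁻¹ • (gK i ^ 2 - gKinv i ^ 2))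
  | e_f_ne (i j : OspIndex r) (hij : i ≠ j) :
      Rel r p (gE i * gF j - sgn i j • (gF j * gE i)) 0
  | e_sq (i : OspIndex r) (hi : IsOddIndex i) : Rel r p (gE i * gE i) 0
  | f_sq (i : OspIndex r) (hi : IsOddIndex i) : Rel r p (gF i * gF i) 0
  | e_comm (i j : OspIndex r) (hij : i ≠ j) (h : cartan i j = 0) :
      Rel r p (gE i * gE j) (gE j * gE i)
  | f_comm (i j : OspIndex r) (hij : i ≠ j) (h : cartan i j = 0) :
      Rel r p (gF i * gF j) (gF j * gF i)
  | e_serre (i j : OspIndex r) (hi : ¬ IsOddIndex i) (hij : i ≠ j) (h : cartan i j ≠ 0) :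
      Rel r p (gE i * gE i * gE j + gE j * gE i * gE i)
        ((p ^ 2 + (p ^ 2)⁻¹) • (gE i * gE j * gE i))
  | f_serre (i j : OspIndex r) (hi : ¬ IsOddIndex i) (hij : i ≠ j) (h : cartan i j ≠ 0) :
      Rel r p (gF i * gF i * gF j + gF j * gF i * gF i)
        ((p ^ 2 + (p ^ 2)⁻¹) • (gF i * gF j * gF i))
  | e_higher (i s j : OspIndex r) (hs : IsOddIndex s) (hi : cartan i s = 1)
      (hj : cartan j s = -1) :
      Rel r p (gE s * gE i * gE s * gE j + gE i * gE s * gE j * gE s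
          + gE j * gE s * gE i * gE s + gE s * gE j * gE s * gE i)
        ((p ^ 2 + (p ^ 2)⁻¹) • (gE s * gE i * gE j * gE s))
  | f_higher (i s j : OspIndex r) (hs : IsOddIndex s) (hi : cartan i s = 1)
      (hj : cartan j s = -1) :
      Rel r p (gF s * gF i * gF s * gF j + gF i * gF s * gF j * gF s
          + gF j * gF s * gF i * gF s + gF s * gF j * gF s * gF i)
        ((p ^ 2 + (p ^ 2)⁻¹) • (gF s * gF i * gF j * gF s))

end UqOsp

/-- The quantum superalgebra `U_q[osp(n|n)]` over `ℂ` with `n = 2r` and `q = p ^ 2`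
(as an associative algebra; its `ℤ/2`-grading is given by the parity of the generators). -/
def UqOsp (r : ℕ) (p : ℂ) : Type := RingQuot (UqOsp.Rel r p)

noncomputable instance (r : ℕ) (p : ℂ) : Ring (UqOsp r p) :=
  inferInstanceAs (Ring (RingQuot (UqOsp.Rel r p)))

noncomputable instance (r : ℕ) (p : ℂ) : Algebra ℂ (UqOsp r p) :=
  inferInstanceAs (Algebra ℂ (RingQuot (UqOsp.Rel r p)))

namespace UqOsp

open OspWeight

/-- The quotient map from the free algebra. -/
noncomputable def mk (r : ℕ) (p : ℂ) : FreeAlgebra ℂ (UqOspGen r) →ₐ[ℂ] UqOsp r p :=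
  RingQuot.mkAlgHom ℂ (Rel r p)

/-- The generators `e_i`, `f_i` and `k_i = q^{h_i/2}` of `U_q[osp(n|n)]`. -/
noncomputable def e {r : ℕ} (p : ℂ) (i : OspIndex r) : UqOsp r p := mk r p (gE i)
noncomputable def f {r : ℕ} (p : ℂ) (i : OspIndex r) : UqOsp r p := mk r p (gF i)
noncomputable def k {r : ℕ} (p : ℂ) (i : OspIndex r) : UqOsp r p := mk r p (gK i)

/-- The counit on generators: `e_i, f_i ↦ 0` and `q^{±h_i/2} ↦ 1`. -/
def counitGen {r : ℕ} : UqOspGen r → ℂ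
  | UqOspGen.e _ => 0
  | UqOspGen.f _ => 0
  | UqOspGen.k _ => 1
  | UqOspGen.kinv _ => 1

theorem counit_rel (r : ℕ) (p : ℂ) ⦃x y : FreeAlgebra ℂ (UqOspGen r)⦄ (h : Rel r p x y) :
    FreeAlgebra.lift ℂ counitGen x = FreeAlgebra.lift ℂ counitGen y := by
  cases h <;> simp [counitGen]

/-- The counit `ε` of `U_q[osp(n|n)]`. -/
noncomputable def counit (r : ℕ) (p : ℂ) : UqOsp r p →ₐ[ℂ] ℂ :=
  RingQuot.liftAlgHom ℂ ⟨FreeAlgebra.lift ℂ counitGen, counit_rel r p⟩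

/-- `M` is a trivial one-dimensional module `V(0̇|0̇)`: every `a` acts as the scalar `ε(a)`. -/
def IsTrivialModule (r : ℕ) (p : ℂ) (M : Type*) [AddCommGroup M] [Module ℂ M]
    [Module (UqOsp r p) M] : Prop :=
  Module.finrank ℂ M = 1 ∧ ∀ (a : UqOsp r p) (x : M), a • x = counit r p a • x

/-- `v` is a maximal (highest weight) vector of weight `wt`: it is nonzero, killed by all `e_i`,
and `q^{h_i/2} v = q^{(α_i, wt)/2} v`. -/
def IsMaximalVector {r : ℕ} (p : ℂ) {V : Type*} [AddCommGroup V] [Module ℂ V]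
    [Module (UqOsp r p) V] (wt : OspWeight r) (v : V) : Prop :=
  v ≠ 0 ∧ (∀ i : OspIndex r, e p i • v = 0) ∧
    ∀ i : OspIndex r, k p i • v = p ^ (form (simpleRoot i) wt) • v

/-- `V = 𝒱 0 ⊕ 𝒱 1` is a `ℤ/2`-graded module over the superalgebra `U_q[osp(n|n)]`. -/
structure IsSuperModule (r : ℕ) (p : ℂ) {V : Type*} [AddCommGroup V] [Module ℂ V]
    [Module (UqOsp r p) V] (𝒱 : ZMod 2 → Submodule ℂ V) : Prop where
  isCompl : IsCompl (𝒱 0) (𝒱 1)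
  e_mem : ∀ (i : OspIndex r) (d : ZMod 2), ∀ x ∈ 𝒱 d, e p i • x ∈ 𝒱 (d + parity i)
  f_mem : ∀ (i : OspIndex r) (d : ZMod 2), ∀ x ∈ 𝒱 d, f p i • x ∈ 𝒱 (d + parity i)
  k_mem : ∀ (i : OspIndex r) (d : ZMod 2), ∀ x ∈ 𝒱 d, k p i • x ∈ 𝒱 d

/-- `W` is a graded submodule: it contains the homogeneous components of its elements. -/
def IsGradedSubmodule {r : ℕ} {p : ℂ} {V : Type*} [AddCommGroup V] [Module ℂ V]
    [Module (UqOsp r p) V] (𝒱 : ZMod 2 → Submodule ℂ V) (W : Submodule (UqOsp r p) V) : Prop :=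
  ∀ x ∈ 𝒱 0, ∀ y ∈ 𝒱 1, x + y ∈ W → x ∈ W ∧ y ∈ W

/-- `V` is indecomposable as a graded module: it is nonzero and is not the direct sum of two
nonzero graded submodules. -/
def IsIndecomposable (r : ℕ) (p : ℂ) {V : Type*} [AddCommGroup V] [Module ℂ V]
    [Module (UqOsp r p) V] (𝒱 : ZMod 2 → Submodule ℂ V) : Prop :=
  Nontrivial V ∧ ∀ W W' : Submodule (UqOsp r p) V, IsGradedSubmodule 𝒱 W →
    IsGradedSubmodule 𝒱 W' → IsCompl W W' → W = ⊥ ∨ W' = ⊥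

/-- For graded submodules `W ⊂ W'`, the factor `W' / W` is irreducible as a graded module. -/
def IsCompositionStep {r : ℕ} {p : ℂ} {V : Type*} [AddCommGroup V] [Module ℂ V]
    [Module (UqOsp r p) V] (𝒱 : ZMod 2 → Submodule ℂ V) (W W' : Submodule (UqOsp r p) V) :
    Prop :=
  W < W' ∧ ∀ X : Submodule (UqOsp r p) V, IsGradedSubmodule 𝒱 X → W ≤ X → X ≤ W' →
    X = W ∨ X = W'

/-- The graded `U_q[osp(n|n)]`-module `V` is indecomposable and has the composition series
`V ⊃ Vbar ⊃ T ⊃ 0` with `Vbar = V̄(δ_1 + δ_2)` cyclically generated by a maximal vector of weight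
`δ_1 + δ_2`, with `T = V(0̇|0̇)`, and with trivial top factor `V / Vbar`. -/
structure HasThetaSeries {r : ℕ} {p : ℂ} {V : Type*} [AddCommGroup V] [Module ℂ V]
    [Module (UqOsp r p) V] [IsScalarTower ℂ (UqOsp r p) V] (𝒱 : ZMod 2 → Submodule ℂ V)
    (Vbar T : Submodule (UqOsp r p) V) : Prop where
  isSuper : IsSuperModule r p 𝒱
  indecomposable : IsIndecomposable r p 𝒱
  graded_Vbar : IsGradedSubmodule 𝒱 Vbar
  graded_T : IsGradedSubmodule 𝒱 T
  step_top : IsCompositionStep 𝒱 Vbar ⊤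
  step_mid : IsCompositionStep 𝒱 T Vbar
  step_bot : IsCompositionStep 𝒱 ⊥ T
  cyclic : ∃ v : V, IsMaximalVector p (theta r) v ∧ Vbar = Submodule.span (UqOsp r p) {v}
  trivial_bot : IsTrivialModule r p T
  trivial_top : IsTrivialModule r p (V ⧸ Vbar)

/-- The space of `U_q[osp(n|n)]`-invariant operators on `V`: the linear operators `A` on `V`
with `a A = A a` for all `a` in `U_q[osp(n|n)]`. -/
def invariantOperators (r : ℕ) (p : ℂ) (V : Type*) [AddCommGroup V] [Module ℂ V]
    [Module (UqOsp r p) V] [IsScalarTower ℂ (UqOsp r p) V] :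
    Submodule ℂ (Module.End ℂ V) where
  carrier := {A | ∀ (a : UqOsp r p) (x : V), A (a • x) = a • A x}
  add_mem' := by
    intro A B hA hB a x
    simp [hA a x, hB a x]
  zero_mem' := by
    intro a x
    simp
  smul_mem' := by
    intro c A hA a x
    simp only [LinearMap.smul_apply, hA a x]
    rw [← algebraMap_smul (UqOsp r p) c (A x), ← algebraMap_smul (UqOsp r p) c (a • A x),
      smul_smul, smul_smul, Algebra.commutes]

end UqOsp

/-! An invariant operator `A` commutes with every `k_j`, so it preserves the weight space of weight
δ_1 + δ_2. That space lies in `Vbar` (`mem_Vbar_of_mem_weightSpace`), because some `k_j` acts on it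
by `p⁻¹ ≠ 1` but trivially on `V ⧸ Vbar`. In the cyclic module `Vbar` it is the line through `v`
(`exists_eq_smul_of_mem_weightSpace`). Hence `A` is a scalar `c` on `Vbar`.

Then `A - c` kills `Vbar` and factors through the trivial top factor, so its image consists of
invariant vectors. By irreducibility of `Vbar / T` and indecomposability of `V`, these are exactly
`T` (`invariants_eq`). Thus `A - c` is a multiple of the map `N : V → V ⧸ Vbar ≃ T → V`.

Here `p = q^{1/2}`; `p` is a root of unity exactly when `q = p ^ 2` is, so `hgen` is the genericity
of `q`. -/

namespace OspWeight

/-! ### Simple roots and the invariant form. -/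

variable {r : ℕ}

theorem form_comm (x y : OspWeight r) : form x y = form y x := by
  simp only [form, mul_comm]

theorem form_zero_right (x : OspWeight r) : form x 0 = 0 := by
  simp [form]

theorem form_add_right (x y z : OspWeight r) : form x (y + z) = form x y + form x z := by
  simp only [form, Pi.add_apply, mul_add, Finset.sum_add_distrib]
  ring

theorem form_sub_right (x y z : OspWeight r) : form x (y - z) = form x y - form x z := by
  simp only [form, Pi.sub_apply, mul_sub, Finset.sum_sub_distrib]
  ring

theorem sum_consecutive (y : Fin r → ℤ) (i : Fin r) (hi : (i : ℕ) + 1 < r) :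
    ∑ j : Fin r, (if j = i then 1 else if (j : ℕ) = i + 1 then -1 else 0) * y j
      = y i - y ⟨i + 1, hi⟩ := by
  have h : ∀ j : Fin r, (if j = i then 1 else if (j : ℕ) = i + 1 then -1 else 0) * y j
      = (if j = i then y j else 0) - (if j = ⟨i + 1, hi⟩ then y j else 0) := by
    intro j
    by_cases h1 : j = i
    · subst h1
      simp [Fin.ext_iff]
    · simp only [h1, if_false, Fin.ext_iff]
      split_ifs <;> simp
  simp [h, Finset.sum_sub_distrib]

theorem form_simpleRoot_inl (y : OspWeight r) (i : Fin r) (hi : (i : ℕ) + 1 < r) :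
    form (simpleRoot (Sum.inl i)) y = y (Sum.inl i) - y (Sum.inl ⟨i + 1, hi⟩) := by
  simp only [form, simpleRoot, hi, if_true, zero_mul, Finset.sum_const_zero, sub_zero]
  exact sum_consecutive (fun j => y (Sum.inl j)) i hi

theorem form_simpleRoot_inl_last (y : OspWeight r) (hr : 2 ≤ r) :
    form (simpleRoot (Sum.inl ⟨r - 1, by lia⟩)) y
      = y (Sum.inl ⟨r - 2, by lia⟩) + y (Sum.inl ⟨r - 1, by lia⟩) := by
  have h : ∀ j : Fin r, (if (j : ℕ) + 2 = r ∨ (j : ℕ) + 1 = r then (1 : ℤ) else 0) * y (Sum.inl j)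
      = (if j = ⟨r - 2, by lia⟩ then y (Sum.inl j) else 0)
        + (if j = ⟨r - 1, by lia⟩ then y (Sum.inl j) else 0) := by
    intro j
    simp only [Fin.ext_iff]
    split_ifs <;> lia
  have hn : ¬ (r - 1 + 1 < r) := by lia
  simp [form, simpleRoot, hn, h, Finset.sum_add_distrib]

theorem form_simpleRoot_inr (y : OspWeight r) (i : Fin r) (hi : (i : ℕ) + 1 < r) :
    form (simpleRoot (Sum.inr i)) y = y (Sum.inr ⟨i + 1, hi⟩) - y (Sum.inr i) := by
  simp only [form, simpleRoot, hi, if_true, zero_mul, Finset.sum_const_zero, zero_sub]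
  rw [sum_consecutive (fun j => y (Sum.inr j)) i hi]
  ring

theorem form_simpleRoot_inr_last (y : OspWeight r) (hr : 0 < r) :
    form (simpleRoot (Sum.inr ⟨r - 1, by lia⟩)) y
      = - y (Sum.inl ⟨0, hr⟩) - y (Sum.inr ⟨r - 1, by lia⟩) := by
  have h : ∀ j : Fin r, (if (j : ℕ) = 0 then (-1 : ℤ) else 0) * y (Sum.inl j)
      = (if j = ⟨0, hr⟩ then - y (Sum.inl j) else 0) := by
    intro j
    simp only [Fin.ext_iff]
    split_ifs <;> simp
  have h' : ∀ j : Fin r, (if j = ⟨r - 1, by lia⟩ then (1 : ℤ)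
      else if (j : ℕ) = r - 1 + 1 then -1 else 0) * y (Sum.inr j)
      = (if j = ⟨r - 1, by lia⟩ then y (Sum.inr j) else 0) := by
    intro j
    have := j.2
    simp only [Fin.ext_iff]
    split_ifs <;> lia
  have hn : ¬ (r - 1 + 1 < r) := by lia
  simp only [form, simpleRoot, hn, if_false, h, h']
  simp

/-- The bilinear form is nondegenerate and the simple roots span rationally. -/
theorem eq_zero_of_form_simpleRoot_eq_zero (hr : 2 ≤ r) (y : OspWeight r)
    (h : ∀ i, form (simpleRoot i) y = 0) : y = 0 := by
  have ha : ∀ (i : ℕ) (hi : i < r), y (Sum.inl ⟨i, hi⟩) = y (Sum.inl ⟨0, by lia⟩) := by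
    intro i
    induction i with
    | zero => intro _; rfl
    | succ i ih =>
      intro hi
      have h1 := h (Sum.inl ⟨i, by lia⟩)
      rw [form_simpleRoot_inl y ⟨i, by lia⟩ hi] at h1
      have h2 := ih (by lia)
      lia
  have hb : ∀ (i : ℕ) (hi : i < r), y (Sum.inr ⟨i, hi⟩) = y (Sum.inr ⟨0, by lia⟩) := by
    intro i
    induction i with
    | zero => intro _; rfl
    | succ i ih =>
      intro hi
      have h1 := h (Sum.inr ⟨i, by lia⟩)
      rw [form_simpleRoot_inr y ⟨i, by lia⟩ hi] at h1
      have h2 := ih (by lia)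
      lia
  -- All ε-coordinates now equal some `a` and all δ-coordinates some `b`; the last two roots give
  -- `2a = 0` and `-a - b = 0`.
  have hl := h (Sum.inl ⟨r - 1, by lia⟩)
  rw [form_simpleRoot_inl_last y hr, ha (r - 2), ha (r - 1)] at hl
  have hs := h (Sum.inr ⟨r - 1, by lia⟩)
  rw [form_simpleRoot_inr_last y (by lia), hb] at hs
  funext j
  rcases j with ⟨i, hi⟩ | ⟨i, hi⟩
  · rw [ha i hi, Pi.zero_apply]; lia
  · rw [hb i hi, Pi.zero_apply]; lia

/-- A weight whose pairing with every simple root is `1`. -/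
def heightWeight (r : ℕ) : OspWeight r
  -- The two roots ε_{r-1} ± ε_r force the last ε-coordinate to be 0; the odd root then forces the
  -- last δ-coordinate to be `-r`. The subtraction is in ℤ.
  | Sum.inl i => r - 1 - i
  | Sum.inr μ => μ + 1 - 2 * r

theorem form_simpleRoot_heightWeight (hr : 2 ≤ r) (i : OspIndex r) :
    form (simpleRoot i) (heightWeight r) = 1 := by
  rcases i with i | i
  · by_cases hi : (i : ℕ) + 1 < r
    · rw [form_simpleRoot_inl _ i hi]
      simp only [heightWeight]
      push_cast
      ring
    · obtain rfl : i = ⟨r - 1, by lia⟩ := Fin.ext (by have := i.2; simp; lia)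
      rw [form_simpleRoot_inl_last _ hr]
      simp only [heightWeight]
      lia
  · by_cases hi : (i : ℕ) + 1 < r
    · rw [form_simpleRoot_inr _ i hi]
      simp only [heightWeight]
      push_cast
      ring
    · obtain rfl : i = ⟨r - 1, by lia⟩ := Fin.ext (by have := i.2; simp; lia)
      rw [form_simpleRoot_inr_last _ (by lia)]
      simp only [heightWeight]
      lia

theorem form_heightWeight_sum (hr : 2 ≤ r) (l : List (OspIndex r)) :
    form (heightWeight r) (l.map simpleRoot).sum = l.length := by
  induction l with
  | nil => simp [form_zero_right]
  | cons i l ih =>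
    rw [List.map_cons, List.sum_cons, form_add_right, ih, form_comm,
      form_simpleRoot_heightWeight hr]
    push_cast [List.length_cons]
    ring

/-- A nonempty sum of simple roots is detected by its pairings with the simple roots. -/
theorem exists_form_sum_ne_zero (hr : 2 ≤ r) {l : List (OspIndex r)} (hl : l ≠ []) :
    ∃ j, form (simpleRoot j) (l.map simpleRoot).sum ≠ 0 := by
  by_contra! h
  have h1 := form_heightWeight_sum hr l
  rw [eq_zero_of_form_simpleRoot_eq_zero hr _ h, form_zero_right] at h1
  exact hl (List.length_eq_zero_iff.1 (by exact_mod_cast h1.symm))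

/-- The root is δ_2 - δ_3, or the odd root δ_2 - ε_1 when `r = 2`; the sign comes from (δ_2, δ_2) =
-1. This separates the weight δ_1 + δ_2 from 0. -/
theorem exists_form_theta_eq_neg_one (hr : 2 ≤ r) :
    ∃ j, form (simpleRoot j) (theta r) = -1 := by
  refine ⟨Sum.inr ⟨1, by lia⟩, ?_⟩
  rcases hr.lt_or_eq with h | h
  · rw [form_simpleRoot_inr (theta r) ⟨1, by lia⟩ h]
    simp [theta]
  · subst h
    exact (form_simpleRoot_inr_last (theta 2) (by lia)).trans (by simp [theta])

end OspWeight

/-! ### Generators, weight vectors and spanning by words in the `f_i`. -/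

namespace UqOsp

open OspWeight

variable {r : ℕ} {p : ℂ}

/-- The generator `q^{-h_i/2}`. -/
noncomputable def kinv (p : ℂ) (i : OspIndex r) : UqOsp r p := mk r p (gKinv i)

theorem mk_rel {x y : FreeAlgebra ℂ (UqOspGen r)} (h : Rel r p x y) : mk r p x = mk r p y :=
  RingQuot.mkAlgHom_rel ℂ h

theorem induction_on {P : UqOsp r p → Prop} (a : UqOsp r p)
    (scalar : ∀ c : ℂ, P (algebraMap ℂ _ c)) (he : ∀ i, P (e p i)) (hf : ∀ i, P (f p i))
    (hk : ∀ i, P (k p i)) (hkinv : ∀ i, P (kinv p i))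
    (mul : ∀ a b, P a → P b → P (a * b)) (add : ∀ a b, P a → P b → P (a + b)) : P a := by
  obtain ⟨x, rfl⟩ : ∃ x, mk r p x = a := RingQuot.mkAlgHom_surjective ℂ (Rel r p) a
  induction x with
  | grade0 c => rw [AlgHom.commutes]; exact scalar c
  | grade1 x =>
    cases x with
    | e i => exact he i
    | f i => exact hf i
    | k i => exact hk i
    | kinv i => exact hkinv i
  | mul a b ha hb => rw [map_mul]; exact mul _ _ ha hb
  | add a b ha hb => rw [map_add]; exact add _ _ ha hb

theorem counit_mk (x : FreeAlgebra ℂ (UqOspGen r)) :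
    counit r p (mk r p x) = FreeAlgebra.lift ℂ counitGen x :=
  RingQuot.liftAlgHom_mkAlgHom_apply ℂ _ _ x

@[simp] theorem counit_e (i : OspIndex r) : counit r p (e p i) = 0 :=
  (counit_mk _).trans (by simp [counitGen])

@[simp] theorem counit_f (i : OspIndex r) : counit r p (f p i) = 0 :=
  (counit_mk _).trans (by simp [counitGen])

@[simp] theorem counit_k (i : OspIndex r) : counit r p (k p i) = 1 :=
  (counit_mk _).trans (by simp [counitGen])

@[simp] theorem counit_kinv (i : OspIndex r) : counit r p (kinv p i) = 1 :=
  (counit_mk _).trans (by simp [counitGen])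

theorem kinv_mul_k (i : OspIndex r) : kinv p i * k p i = 1 := by
  simpa [kinv, k] using mk_rel (Rel.kinv_k (p := p) i)

theorem k_mul_k (i j : OspIndex r) : k p i * k p j = k p j * k p i := by
  simpa [k] using mk_rel (Rel.k_comm (p := p) i j)

theorem k_mul_f (i j : OspIndex r) :
    k p i * f p j = p ^ (-cartan i j) • (f p j * k p i) := by
  simpa [k, f] using mk_rel (Rel.k_f (p := p) i j)

theorem e_mul_f_same (i : OspIndex r) :
    e p i * f p i = sgn i i • (f p i * e p i)
      + (p ^ 2 - (p ^ 2)⁻¹)⁻¹ • (k p i ^ 2 - kinv p i ^ 2) := by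
  have h := mk_rel (Rel.e_f_same (p := p) i)
  simp only [map_sub, map_mul, map_smul, map_pow] at h
  rw [sub_eq_iff_eq_add'] at h
  exact h

theorem e_mul_f_ne {i j : OspIndex r} (hij : i ≠ j) :
    e p i * f p j = sgn i j • (f p j * e p i) := by
  have h := mk_rel (Rel.e_f_ne (p := p) i j hij)
  simp only [map_sub, map_mul, map_smul, map_zero] at h
  exact sub_eq_zero.1 h

variable {V : Type*} [AddCommGroup V] [Module ℂ V] [Module (UqOsp r p) V]
  [IsScalarTower ℂ (UqOsp r p) V]

theorem smul_smul_comm (a : UqOsp r p) (c : ℂ) (x : V) : a • c • x = c • a • x := by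
  rw [← algebraMap_smul (UqOsp r p) c x, ← algebraMap_smul (UqOsp r p) c (a • x),
    smul_smul, smul_smul, Algebra.commutes]

theorem smul_mem_of_generators {W : Submodule ℂ V} (he : ∀ i : OspIndex r, ∀ x ∈ W, e p i • x ∈ W)
    (hf : ∀ i : OspIndex r, ∀ x ∈ W, f p i • x ∈ W)
    (hk : ∀ i : OspIndex r, ∀ x ∈ W, k p i • x ∈ W)
    (hkinv : ∀ i : OspIndex r, ∀ x ∈ W, kinv p i • x ∈ W) (a : UqOsp r p) : ∀ x ∈ W, a • x ∈ W := by
  induction a using induction_on with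
  | scalar c => intro x hx; rw [algebraMap_smul]; exact W.smul_mem c hx
  | he i => exact he i
  | hf i => exact hf i
  | hk i => exact hk i
  | hkinv i => exact hkinv i
  | mul a b ha hb => intro x hx; rw [mul_smul]; exact ha _ (hb _ hx)
  | add a b ha hb => intro x hx; rw [add_smul]; exact W.add_mem (ha _ hx) (hb _ hx)

/-- The weight space of weight `wt`. -/
noncomputable def weightSpace (r : ℕ) (p : ℂ) (V : Type*) [AddCommGroup V] [Module ℂ V]
    [Module (UqOsp r p) V] [IsScalarTower ℂ (UqOsp r p) V] (wt : OspWeight r) :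
    Submodule ℂ V where
  carrier := {x | ∀ j, k p j • x = p ^ form (simpleRoot j) wt • x}
  add_mem' := by
    intro x y hx hy j
    rw [smul_add, hx j, hy j, smul_add]
  zero_mem' := by
    intro j
    simp
  smul_mem' := by
    intro c x hx j
    rw [smul_smul_comm, hx j, smul_comm]

theorem kinv_smul_of_mem_weightSpace (hp : p ≠ 0) {wt : OspWeight r} {x : V}
    (hx : x ∈ weightSpace r p V wt) (j : OspIndex r) :
    kinv p j • x = (p ^ form (simpleRoot j) wt)⁻¹ • x := by
  rw [eq_inv_smul_iff₀ (zpow_ne_zero _ hp), ← smul_smul_comm, ← hx j, ← mul_smul, kinv_mul_k,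
    one_smul]

theorem f_smul_mem_weightSpace (hp : p ≠ 0) {wt : OspWeight r} {x : V}
    (hx : x ∈ weightSpace r p V wt) (i : OspIndex r) :
    f p i • x ∈ weightSpace r p V (wt - simpleRoot i) := by
  intro j
  rw [← mul_smul, k_mul_f, smul_assoc, mul_smul, hx j, smul_smul_comm, smul_smul,
    ← zpow_add₀ hp, form_sub_right, cartan]
  congr 2
  ring

/-- The vector obtained from `v` by applying a word in the generators `f_i`. -/
noncomputable def fWord {r : ℕ} (p : ℂ) {V : Type*} [AddCommGroup V]
    [Module (UqOsp r p) V] (v : V) : List (OspIndex r) → V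
  | [] => v
  | i :: l => f p i • fWord p v l

theorem fWord_mem_weightSpace (hp : p ≠ 0) {wt : OspWeight r} {v : V}
    (hv : v ∈ weightSpace r p V wt) (l : List (OspIndex r)) :
    fWord p v l ∈ weightSpace r p V (wt - (l.map simpleRoot).sum) := by
  induction l with
  | nil => simpa [fWord] using hv
  | cons i l ih =>
    have h := f_smul_mem_weightSpace hp ih i
    rwa [sub_sub, add_comm] at h

theorem f_smul_mem_span_fWord {v x : V} (i : OspIndex r)
    (hx : x ∈ Submodule.span ℂ (Set.range (fWord (r := r) p v))) :
    f p i • x ∈ Submodule.span ℂ (Set.range (fWord (r := r) p v)) := by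
  induction hx using Submodule.span_induction with
  | mem x hx =>
    obtain ⟨l, rfl⟩ := hx
    exact Submodule.subset_span ⟨i :: l, rfl⟩
  | zero => simp
  | add x y _ _ hx hy => rw [smul_add]; exact Submodule.add_mem _ hx hy
  | smul c x _ hx => rw [smul_smul_comm]; exact Submodule.smul_mem _ c hx

/-- Moving `e_i` past the leading `f_j` leaves `f_j` applied to a vector of the span by induction
and, if `i = j`, a Cartan term that is scalar on the weight vector. The Serre relations play no
role. -/
theorem e_smul_fWord_mem (hp : p ≠ 0) {wt : OspWeight r} {v : V}
    (hv : IsMaximalVector p wt v) (i : OspIndex r) (l : List (OspIndex r)) :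
    e p i • fWord p v l ∈ Submodule.span ℂ (Set.range (fWord (r := r) p v)) := by
  induction l with
  | nil => simp [fWord, hv.2.1 i]
  | cons j l ih =>
    rw [fWord, ← mul_smul]
    by_cases hij : i = j
    · subst hij
      have hl := fWord_mem_weightSpace hp (V := V) (wt := wt) (v := v) hv.2.2 l
      have hmem : fWord p v l ∈ Submodule.span ℂ (Set.range (fWord (r := r) p v)) :=
        Submodule.subset_span ⟨l, rfl⟩
      rw [e_mul_f_same, add_smul, smul_assoc, smul_assoc, mul_smul, sub_smul, pow_two (k p i),
        pow_two (kinv p i), mul_smul, mul_smul, hl i, kinv_smul_of_mem_weightSpace hp hl i, smul_smul_comm,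
        smul_smul_comm, hl i, kinv_smul_of_mem_weightSpace hp hl i]
      refine Submodule.add_mem _ (Submodule.smul_mem _ _ (f_smul_mem_span_fWord i ih)) ?_
      refine Submodule.smul_mem _ _ (Submodule.sub_mem _ ?_ ?_) <;>
        exact Submodule.smul_mem _ _ (Submodule.smul_mem _ _ hmem)
    · rw [e_mul_f_ne hij, smul_assoc, mul_smul]
      exact Submodule.smul_mem _ _ (f_smul_mem_span_fWord j ih)

/-- The module generated by a maximal vector is spanned by words in the `f_i` applied to it. -/
theorem mem_span_fWord (hp : p ≠ 0) {wt : OspWeight r} {v : V}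
    (hv : IsMaximalVector p wt v) {x : V} (hx : x ∈ Submodule.span (UqOsp r p) {v}) :
    x ∈ Submodule.span ℂ (Set.range (fWord (r := r) p v)) := by
  obtain ⟨a, rfl⟩ := Submodule.mem_span_singleton.1 hx
  have key : ∀ g : UqOsp r p,
      (∀ l : List (OspIndex r), g • fWord p v l ∈ Submodule.span ℂ (Set.range (fWord (r := r) p v))) →
      ∀ x ∈ Submodule.span ℂ (Set.range (fWord (r := r) p v)),
        g • x ∈ Submodule.span ℂ (Set.range (fWord (r := r) p v)) := by
    intro g hg x hx
    induction hx using Submodule.span_induction with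
    | mem x hx => obtain ⟨l, rfl⟩ := hx; exact hg l
    | zero => simp
    | add x y _ _ hx hy => rw [smul_add]; exact Submodule.add_mem _ hx hy
    | smul c x _ hx => rw [smul_smul_comm]; exact Submodule.smul_mem _ c hx
  have hl := fWord_mem_weightSpace hp (V := V) (wt := wt) (v := v) hv.2.2
  -- The span is stable under all generators and contains `v`, the empty word.
  refine smul_mem_of_generators (fun i => key _ (e_smul_fWord_mem hp hv i))
    (fun i x => f_smul_mem_span_fWord i) (fun i => key _ fun l => ?_)
    (fun i => key _ fun l => ?_) a v (Submodule.subset_span ⟨[], rfl⟩)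
  · rw [hl l i]
    exact Submodule.smul_mem _ _ (Submodule.subset_span ⟨l, rfl⟩)
  · rw [kinv_smul_of_mem_weightSpace hp (hl l) i]
    exact Submodule.smul_mem _ _ (Submodule.subset_span ⟨l, rfl⟩)

/-! ### Separation of weights and the highest weight space. -/

theorem zpow_ne_one (hgen : ∀ m : ℕ, 0 < m → p ^ m ≠ 1) {m : ℤ} (hm : m ≠ 0) : p ^ m ≠ 1 := by
  obtain ⟨n, rfl | rfl⟩ := m.eq_nat_or_neg
  · rw [zpow_natCast]
    exact hgen n (by lia)
  · rw [zpow_neg, zpow_natCast, Ne, inv_eq_one]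
    exact hgen n (by lia)

/-- The action of `q^{h_j/2}` as a linear operator. -/
noncomputable def kEnd (p : ℂ) (V : Type*) [AddCommGroup V] [Module ℂ V]
    [Module (UqOsp r p) V] [IsScalarTower ℂ (UqOsp r p) V] (j : OspIndex r) : Module.End ℂ V where
  toFun x := k p j • x
  map_add' := smul_add _
  map_smul' c x := smul_smul_comm _ c x

theorem weightSpace_le_iInf_maxGenEigenspace (wt : OspWeight r) :
    weightSpace r p V wt
      ≤ ⨅ j, (kEnd p V j).maxGenEigenspace (p ^ form (simpleRoot j) wt) := by
  refine le_iInf fun j => le_trans ?_ (Module.End.eigenspace_le_maxGenEigenspace ..)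
  intro x hx
  exact Module.End.mem_eigenspace_iff.2 (hx j)

/-- The `k_j` commute, so each preserves the generalized eigenspaces of the others, and joint ones
for distinct characters are independent. -/
theorem iSupIndep_maxGenEigenspace_kEnd :
    iSupIndep fun χ : OspIndex r → ℂ => ⨅ j, (kEnd p V j).maxGenEigenspace (χ j) := by
  refine Module.End.independent_iInf_maxGenEigenspace_of_forall_mapsTo _ fun i j φ => ?_
  refine Module.End.mapsTo_maxGenEigenspace_of_comm ?_ φ
  ext x
  change k p j • k p i • x = k p i • k p j • x
  rw [← mul_smul, ← mul_smul, k_mul_k]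

/-- The highest weight space of a cyclic highest weight module is one-dimensional. -/
theorem exists_eq_smul_of_mem_weightSpace (hr : 2 ≤ r) (hp : p ≠ 0)
    (hgen : ∀ m : ℕ, 0 < m → p ^ m ≠ 1) {wt : OspWeight r} {v : V}
    (hv : IsMaximalVector p wt v) {x : V} (hx : x ∈ Submodule.span (UqOsp r p) {v})
    (hwt : x ∈ weightSpace r p V wt) : ∃ c : ℂ, x = c • v := by
  set E : (OspIndex r → ℂ) → Submodule ℂ V :=
    fun χ => ⨅ j, (kEnd p V j).maxGenEigenspace (χ j) with hE
  set χ₀ : OspIndex r → ℂ := fun j => p ^ form (simpleRoot j) wt with hχ₀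
  -- A nonempty word lowers the weight by a nonempty sum of simple roots. Some `k_j` detects this
  -- sum, since `p` is not a root of unity.
  have hsup : Submodule.span ℂ (Set.range (fWord (r := r) p v))
      ≤ Submodule.span ℂ {v} ⊔ ⨆ χ, ⨆ _ : χ ≠ χ₀, E χ := by
    rw [Submodule.span_le]
    rintro _ ⟨l, rfl⟩
    rcases eq_or_ne l [] with rfl | hl
    · exact Submodule.mem_sup_left (Submodule.mem_span_singleton_self v)
    · obtain ⟨j, hj⟩ := exists_form_sum_ne_zero hr hl
      refine Submodule.mem_sup_right (Submodule.mem_iSup_of_mem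
        (fun j => p ^ form (simpleRoot j) (wt - (l.map simpleRoot).sum))
        (Submodule.mem_iSup_of_mem ?_ ?_))
      · intro h
        have h1 := congrFun h j
        simp only [hχ₀, form_sub_right, zpow_sub₀ hp] at h1
        rw [div_eq_iff (zpow_ne_zero _ hp), eq_comm,
          mul_eq_left₀ (zpow_ne_zero _ hp)] at h1
        exact zpow_ne_one hgen hj h1
      · exact weightSpace_le_iInf_maxGenEigenspace _ (fWord_mem_weightSpace hp hv.2.2 l)
  obtain ⟨y, hy, z, hz, hyz⟩ := Submodule.mem_sup.1 (hsup (mem_span_fWord hp hv hx))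
  obtain ⟨c, rfl⟩ := Submodule.mem_span_singleton.1 hy
  refine ⟨c, ?_⟩
  -- `z = x - c • v` also has weight `wt`, so independence forces `z = 0`.
  have hz' : z ∈ E χ₀ := by
    refine weightSpace_le_iInf_maxGenEigenspace wt ?_
    rw [← add_sub_cancel_left (c • v) z, hyz]
    exact Submodule.sub_mem _ hwt (Submodule.smul_mem _ c hv.2.2)
  have hz0 : z = 0 :=
    Submodule.disjoint_def.1 (iSupIndep_maxGenEigenspace_kEnd χ₀) z hz' hz
  rw [← hyz, hz0, add_zero]

end UqOsp

/-! ### The grading and the invariant vectors. -/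

namespace UqOsp

open OspWeight

variable {r : ℕ} {p : ℂ} {V : Type*} [AddCommGroup V] [Module ℂ V] [Module (UqOsp r p) V]
  {𝒱 : ZMod 2 → Submodule ℂ V}

/-- The shift `d` covers odd generators, which exchange the two components. -/
theorem IsSuperModule.eq_zero_of_add_eq_zero (h : IsSuperModule r p 𝒱) (d : ZMod 2) {x y : V}
    (hx : x ∈ 𝒱 (0 + d)) (hy : y ∈ 𝒱 (1 + d)) (hxy : x + y = 0) : x = 0 ∧ y = 0 := by
  have key : ∀ {x y : V}, x ∈ 𝒱 0 → y ∈ 𝒱 1 → x + y = 0 → x = 0 := by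
    intro x y hx hy hxy
    refine Submodule.disjoint_def.1 h.isCompl.disjoint x hx ?_
    rw [eq_neg_of_add_eq_zero_left hxy]
    exact Submodule.neg_mem _ hy
  have hx0 : x = 0 := by
    fin_cases d
    · exact key hx hy hxy
    · have hy0 := key (x := y) (y := x) hy hx (by rwa [add_comm])
      simpa [hy0] using hxy
  exact ⟨hx0, by simpa [hx0] using hxy⟩

theorem IsGradedSubmodule.inf {W W' : Submodule (UqOsp r p) V} (h : IsGradedSubmodule 𝒱 W)
    (h' : IsGradedSubmodule 𝒱 W') : IsGradedSubmodule 𝒱 (W ⊓ W') :=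
  fun x hx y hy hxy =>
    ⟨⟨(h x hx y hy hxy.1).1, (h' x hx y hy hxy.2).1⟩,
      ⟨(h x hx y hy hxy.1).2, (h' x hx y hy hxy.2).2⟩⟩

variable [IsScalarTower ℂ (UqOsp r p) V]

variable (r p V) in
/-- The submodule of vectors on which every `a` acts as `ε(a)`. -/
noncomputable def invariants : Submodule (UqOsp r p) V where
  carrier := {x | ∀ a : UqOsp r p, a • x = counit r p a • x}
  add_mem' := by
    intro x y hx hy a
    rw [smul_add, hx a, hy a, smul_add]
  zero_mem' := by
    intro a
    simp
  smul_mem' := by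
    intro b x hx a
    rw [hx b, smul_smul_comm, hx a, smul_comm]

theorem mem_invariants_of_generators {x : V} (he : ∀ i : OspIndex r, e p i • x = 0)
    (hf : ∀ i : OspIndex r, f p i • x = 0) (hk : ∀ i : OspIndex r, k p i • x = x) : x ∈ invariants r p V := by
  intro a
  induction a using induction_on with
  | scalar c => rw [algebraMap_smul, AlgHom.commutes]; rfl
  | he i => simp [he i]
  | hf i => simp [hf i]
  | hk i => simp [hk i]
  | hkinv i =>
    conv_lhs => rw [← hk i]
    rw [← mul_smul, kinv_mul_k, counit_kinv, one_smul, one_smul]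
  | mul a b ha hb => rw [mul_smul, hb, smul_smul_comm, ha, smul_smul, map_mul, mul_comm]
  | add a b ha hb => rw [add_smul, ha, hb, map_add, add_smul]

/-- The conditions `e_i x = 0`, `f_i x = 0`, `(k_i - 1) x = 0` involve homogeneous operators, so
they split into components. Gradedness matters because irreducibility and indecomposability only
concern graded submodules. -/
theorem isGradedSubmodule_invariants (h : IsSuperModule r p 𝒱) :
    IsGradedSubmodule 𝒱 (invariants r p V) := by
  intro x hx y hy hxy
  have he := fun i => h.eq_zero_of_add_eq_zero _ (h.e_mem i 0 x hx) (h.e_mem i 1 y hy)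
    (by rw [← smul_add, hxy, counit_e, zero_smul])
  have hf := fun i => h.eq_zero_of_add_eq_zero _ (h.f_mem i 0 x hx) (h.f_mem i 1 y hy)
    (by rw [← smul_add, hxy, counit_f, zero_smul])
  have hk := fun i => h.eq_zero_of_add_eq_zero 0
    (by simpa using Submodule.sub_mem _ (h.k_mem i 0 x hx) hx)
    (by simpa using Submodule.sub_mem _ (h.k_mem i 1 y hy) hy)
    (by rw [sub_add_sub_comm, ← smul_add, hxy, counit_k, one_smul, sub_self])
  exact ⟨mem_invariants_of_generators (fun i => (he i).1) (fun i => (hf i).1)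
      fun i => sub_eq_zero.1 (hk i).1,
    mem_invariants_of_generators (fun i => (he i).2) (fun i => (hf i).2)
      fun i => sub_eq_zero.1 (hk i).2⟩

theorem mem_span_singleton_of_mem_invariants {x y : V} (hx : x ∈ invariants r p V) :
    y ∈ Submodule.span (UqOsp r p) {x} ↔ ∃ c : ℂ, c • x = y := by
  rw [Submodule.mem_span_singleton]
  constructor
  · rintro ⟨a, rfl⟩
    exact ⟨_, (hx a).symm⟩
  · rintro ⟨c, rfl⟩
    exact ⟨algebraMap ℂ _ c, algebraMap_smul _ c x⟩

theorem isGradedSubmodule_span_invariant (h : IsSuperModule r p 𝒱) {x : V}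
    (hx : x ∈ invariants r p V) (hd : x ∈ 𝒱 0 ∨ x ∈ 𝒱 1) :
    IsGradedSubmodule 𝒱 (Submodule.span (UqOsp r p) {x}) := by
  intro y hy z hz hyz
  obtain ⟨c, hc⟩ := (mem_span_singleton_of_mem_invariants hx).1 hyz
  rcases hd with hd | hd
  · obtain ⟨-, rfl⟩ := h.eq_zero_of_add_eq_zero 0
      (x := y - c • x) (y := z)
      (by simpa using Submodule.sub_mem _ hy (Submodule.smul_mem _ c hd)) (by simpa using hz)
      (by rw [hc]; abel)
    exact ⟨by simpa using hyz, Submodule.zero_mem _⟩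
  · obtain ⟨rfl, -⟩ := h.eq_zero_of_add_eq_zero 0
      (x := y) (y := z - c • x) (by simpa using hy)
      (by simpa using Submodule.sub_mem _ hz (Submodule.smul_mem _ c hd))
      (by rw [hc]; abel)
    exact ⟨Submodule.zero_mem _, by simpa using hyz⟩

theorem IsMaximalVector.not_mem_invariants (hr : 2 ≤ r)
    (hgen : ∀ m : ℕ, 0 < m → p ^ m ≠ 1) {v : V} (hv : IsMaximalVector p (theta r) v) :
    v ∉ invariants r p V := by
  intro h
  obtain ⟨j, hj⟩ := exists_form_theta_eq_neg_one hr
  have h1 := h (k p j)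
  rw [hv.2.2 j, counit_k, hj] at h1
  exact zpow_ne_one hgen (by norm_num) (smul_left_injective ℂ hv.1 h1)

/-! ### Consequences of the composition series. -/

namespace HasThetaSeries

variable {Vbar T : Submodule (UqOsp r p) V}

theorem smul_sub_mem (h : HasThetaSeries 𝒱 Vbar T) (a : UqOsp r p) (x : V) :
    a • x - counit r p a • x ∈ Vbar :=
  (Submodule.Quotient.eq Vbar).1 (h.trivial_top.2 a (Submodule.Quotient.mk x))

theorem exists_sub_smul_mem (h : HasThetaSeries 𝒱 Vbar T) {x : V} (hx : x ∉ Vbar) (y : V) :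
    ∃ c : ℂ, y - c • x ∈ Vbar := by
  obtain ⟨c, hc⟩ := exists_smul_eq_of_finrank_eq_one h.trivial_top.1
    (x := Submodule.Quotient.mk x) (by rwa [Ne, Submodule.Quotient.mk_eq_zero])
    (Submodule.Quotient.mk y)
  exact ⟨c, (Submodule.Quotient.eq Vbar).1 hc.symm⟩

theorem T_le_invariants (h : HasThetaSeries 𝒱 Vbar T) : T ≤ invariants r p V := by
  intro x hx a
  exact congrArg Subtype.val (h.trivial_bot.2 a ⟨x, hx⟩)

/-- The intersection is graded and lies between `T` and `Vbar`, so it is one of them; the maximal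
vector, not being invariant, excludes `Vbar`. -/
theorem invariants_inf_Vbar (h : HasThetaSeries 𝒱 Vbar T) (hr : 2 ≤ r)
    (hgen : ∀ m : ℕ, 0 < m → p ^ m ≠ 1) : invariants r p V ⊓ Vbar = T := by
  refine (h.step_mid.2 _ ((isGradedSubmodule_invariants h.isSuper).inf h.graded_Vbar)
    (le_inf h.T_le_invariants h.step_mid.1.le) inf_le_right).resolve_right fun heq => ?_
  obtain ⟨v, hv, hVbar⟩ := h.cyclic
  have hvm : v ∈ Vbar := hVbar ▸ Submodule.mem_span_singleton_self v
  exact hv.not_mem_invariants hr hgen (heq.ge hvm).1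

/-- A homogeneous invariant outside `Vbar`, which has codimension one, would span a graded
complement of it, against indecomposability. The general case follows by taking components. -/
theorem invariants_le_Vbar (h : HasThetaSeries 𝒱 Vbar T) : invariants r p V ≤ Vbar := by
  have hom : ∀ x ∈ invariants r p V, x ∈ 𝒱 0 ∨ x ∈ 𝒱 1 → x ∈ Vbar := by
    intro x hx hd
    by_contra hxV
    have hc : IsCompl (Submodule.span (UqOsp r p) {x}) Vbar := by
      constructor
      · rw [Submodule.disjoint_def]
        intro y hy hyV
        obtain ⟨c, rfl⟩ := (mem_span_singleton_of_mem_invariants hx).1 hy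
        rcases eq_or_ne c 0 with rfl | hc
        · exact zero_smul _ _
        · refine absurd ?_ hxV
          have := (Vbar.restrictScalars ℂ).smul_mem c⁻¹ hyV
          rwa [inv_smul_smul₀ hc] at this
      · rw [codisjoint_iff, eq_top_iff]
        intro y _
        obtain ⟨c, hc⟩ := h.exists_sub_smul_mem hxV y
        rw [← add_sub_cancel (c • x) y]
        exact Submodule.add_mem_sup ((mem_span_singleton_of_mem_invariants hx).2 ⟨c, rfl⟩) hc
    rcases h.indecomposable.2 _ _ (isGradedSubmodule_span_invariant h.isSuper hx hd)
      h.graded_Vbar hc with h1 | h1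
    · rw [Submodule.span_singleton_eq_bot] at h1
      exact hxV (h1 ▸ Vbar.zero_mem)
    · exact absurd h.step_mid.1 (h1 ▸ not_lt_bot)
  intro x hx
  obtain ⟨y, hy, z, hz, rfl⟩ := Submodule.mem_sup.1
    (h.isSuper.isCompl.sup_eq_top.ge (Submodule.mem_top (x := x)))
  obtain ⟨hy', hz'⟩ := isGradedSubmodule_invariants h.isSuper y hy z hz hx
  exact Vbar.add_mem (hom y hy' (Or.inl hy)) (hom z hz' (Or.inr hz))

theorem invariants_eq (h : HasThetaSeries 𝒱 Vbar T) (hr : 2 ≤ r)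
    (hgen : ∀ m : ℕ, 0 < m → p ^ m ≠ 1) : invariants r p V = T := by
  rw [← h.invariants_inf_Vbar hr hgen, inf_eq_left.2 h.invariants_le_Vbar]

/-- The weight space of weight `δ_1 + δ_2` of `V` lies in `Vbar`. -/
theorem mem_Vbar_of_mem_weightSpace (h : HasThetaSeries 𝒱 Vbar T) (hr : 2 ≤ r)
    (hgen : ∀ m : ℕ, 0 < m → p ^ m ≠ 1) {x : V} (hx : x ∈ weightSpace r p V (theta r)) :
    x ∈ Vbar := by
  obtain ⟨j, hj⟩ := exists_form_theta_eq_neg_one hr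
  -- `k_j - 1` maps `V` into `Vbar` and multiplies `x` by the nonzero number `p⁻¹ - 1`.
  have h1 := h.smul_sub_mem (k p j) x
  rw [hx j, counit_k, hj, ← sub_smul] at h1
  have h2 : p ^ (-1 : ℤ) - 1 ≠ 0 := sub_ne_zero.2 (zpow_ne_one hgen (by norm_num))
  have h3 := (Vbar.restrictScalars ℂ).smul_mem (p ^ (-1 : ℤ) - 1)⁻¹ h1
  rwa [inv_smul_smul₀ h2] at h3

/-- An invariant operator is a scalar on `Vbar`. -/
theorem exists_scalar (h : HasThetaSeries 𝒱 Vbar T) (hr : 2 ≤ r) (hp : p ≠ 0)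
    (hgen : ∀ m : ℕ, 0 < m → p ^ m ≠ 1) {A : Module.End ℂ V}
    (hA : A ∈ invariantOperators r p V) : ∃ c : ℂ, ∀ x ∈ Vbar, A x = c • x := by
  obtain ⟨v, hv, hVbar⟩ := h.cyclic
  have hAv : A v ∈ weightSpace r p V (theta r) := by
    intro j
    rw [← hA, hv.2.2 j, map_smul]
  obtain ⟨c, hc⟩ := exists_eq_smul_of_mem_weightSpace hr hp hgen hv
    (hVbar ▸ h.mem_Vbar_of_mem_weightSpace hr hgen hAv) hAv
  refine ⟨c, fun x hx => ?_⟩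
  rw [hVbar] at hx
  obtain ⟨a, rfl⟩ := Submodule.mem_span_singleton.1 hx
  rw [hA, hc, smul_smul_comm]

/-- An invariant operator that kills `Vbar` maps `V` to the invariants. -/
theorem apply_mem_invariants (h : HasThetaSeries 𝒱 Vbar T) {B : Module.End ℂ V}
    (hB : B ∈ invariantOperators r p V) (h0 : ∀ x ∈ Vbar, B x = 0) (x : V) :
    B x ∈ invariants r p V := by
  intro a
  have h1 := h0 _ (h.smul_sub_mem a x)
  rwa [map_sub, sub_eq_zero, hB, map_smul] at h1

/-- There is an invariant operator with kernel `Vbar` and image `T`. -/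
theorem exists_invariantOperator (h : HasThetaSeries 𝒱 Vbar T) :
    ∃ N ∈ invariantOperators r p V, (∀ x, N x = 0 ↔ x ∈ Vbar) ∧
      LinearMap.range N = T.restrictScalars ℂ := by
  have := FiniteDimensional.of_finrank_pos (h.trivial_top.1 ▸ one_pos)
  have := FiniteDimensional.of_finrank_pos (h.trivial_bot.1 ▸ one_pos)
  -- Both factors are lines on which `a` acts as `ε(a)`, so any linear isomorphism is equivariant.
  let φ : (V ⧸ Vbar) ≃ₗ[ℂ] T :=
    LinearEquiv.ofFinrankEq _ _ (h.trivial_top.1.trans h.trivial_bot.1.symm)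
  let π : V →ₗ[ℂ] (V ⧸ Vbar) := Vbar.mkQ.restrictScalars ℂ
  let N : Module.End ℂ V := (T.restrictScalars ℂ).subtype ∘ₗ φ.toLinearMap ∘ₗ π
  have hN : ∀ x, N x = φ (Submodule.Quotient.mk x) := fun x => rfl
  refine ⟨N, fun a x => ?_, fun x => ?_, ?_⟩
  · rw [hN, hN, Submodule.Quotient.mk_smul, h.trivial_top.2 a, map_smul]
    exact (h.T_le_invariants (φ (Submodule.Quotient.mk x)).2 a).symm
  · rw [hN, ZeroMemClass.coe_eq_zero, φ.map_eq_zero_iff, Submodule.Quotient.mk_eq_zero]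
  · ext y
    constructor
    · rintro ⟨x, rfl⟩
      exact (φ (Submodule.Quotient.mk x)).2
    · intro hy
      obtain ⟨x, hx⟩ := Submodule.Quotient.mk_surjective Vbar (φ.symm ⟨y, hy⟩)
      exact ⟨x, by rw [hN, hx, φ.apply_symm_apply]⟩

end HasThetaSeries

end UqOsp

/-! ### The space of invariant operators. -/

theorem proposition1 (r : ℕ) (hr : 2 ≤ r) (p : ℂ) (hp : p ≠ 0)
    (hgen : ∀ m : ℕ, 0 < m → p ^ m ≠ 1)
    (V : Type*) [AddCommGroup V] [Module ℂ V] [FiniteDimensional ℂ V]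
    [Module (UqOsp r p) V] [IsScalarTower ℂ (UqOsp r p) V]
    (𝒱 : ZMod 2 → Submodule ℂ V) (Vbar T : Submodule (UqOsp r p) V)
    (hV : UqOsp.HasThetaSeries 𝒱 Vbar T) :
    Module.finrank ℂ (UqOsp.invariantOperators r p V) = 2 ∧
    ∃ N : Module.End ℂ V,
      N ∈ UqOsp.invariantOperators r p V ∧
      IsNilpotent N ∧
      LinearMap.range N = T.restrictScalars ℂ ∧
      N ^ 2 = 0 ∧
      UqOsp.invariantOperators r p V = Submodule.span ℂ {LinearMap.id, N} ∧
      ∀ N' : Module.End ℂ V, N' ∈ UqOsp.invariantOperators r p V → IsNilpotent N' →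
        ∃ c : ℂ, N' = c • N := by
  obtain ⟨N, hN, hker, hrange⟩ := hV.exists_invariantOperator
  have hNT : ∀ x, N x ∈ T := fun x => hrange.le ⟨x, rfl⟩
  have hTV : T ≤ Vbar := hV.step_mid.1.le
  have hsq : N ^ 2 = 0 := by
    ext x
    rw [pow_two, Module.End.mul_apply, LinearMap.zero_apply, hker]
    exact hTV (hNT x)
  have hid : LinearMap.id ∈ UqOsp.invariantOperators r p V := fun a x => rfl
  -- Two test vectors: `N` kills `t` but not `x`. On `t` one reads off the coefficient of the
  -- identity, then on `x` that of `N`.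
  obtain ⟨t, htT, ht⟩ := Submodule.exists_mem_ne_zero_of_ne_bot hV.step_bot.1.ne'
  obtain ⟨x, -, hx⟩ := SetLike.exists_of_lt hV.step_top.1
  have hNx : N x ≠ 0 := fun h => hx ((hker x).1 h)
  have hdec : ∀ A ∈ UqOsp.invariantOperators r p V, ∃ c d : ℂ, A = c • LinearMap.id + d • N := by
    intro A hA
    obtain ⟨c, hc⟩ := hV.exists_scalar hr hp hgen hA
    have hB : A - c • LinearMap.id ∈ UqOsp.invariantOperators r p V :=
      Submodule.sub_mem _ hA (Submodule.smul_mem _ c hid)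
    have hB0 : ∀ y ∈ Vbar, (A - c • LinearMap.id : Module.End ℂ V) y = 0 := by
      intro y hy
      simp [hc y hy]
    have hBx := hV.apply_mem_invariants hB hB0 x
    rw [hV.invariants_eq hr hgen] at hBx
    obtain ⟨d, hd⟩ := exists_smul_eq_of_finrank_eq_one hV.trivial_bot.1
      (x := (⟨N x, hNT x⟩ : T)) (by simpa using hNx) ⟨_, hBx⟩
    have hd' : d • N x = (A - c • LinearMap.id : Module.End ℂ V) x := congrArg Subtype.val hd
    refine ⟨c, d, ?_⟩
    -- `A - c` and `d • N` both kill `Vbar` and agree at `x`, which spans `V` modulo `Vbar`.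
    rw [← sub_eq_iff_eq_add']
    ext y
    obtain ⟨b, hb⟩ := hV.exists_sub_smul_mem hx y
    have h1 := hB0 _ hb
    have h2 := (hker _).2 hb
    rw [map_sub, map_smul, sub_eq_zero] at h1 h2
    rw [h1, LinearMap.smul_apply, h2, ← hd', smul_comm]
  have hspan : UqOsp.invariantOperators r p V = Submodule.span ℂ {LinearMap.id, N} := by
    refine le_antisymm (fun A hA => ?_) (Submodule.span_le.2 ?_)
    · obtain ⟨c, d, rfl⟩ := hdec A hA
      exact Submodule.mem_span_pair.2 ⟨c, d, rfl⟩
    · rintro _ (rfl | rfl)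
      exacts [hid, hN]
  have hNt : N t = 0 := (hker t).2 (hTV htT)
  have hli : LinearIndependent ℂ ![LinearMap.id, N] := by
    rw [LinearIndependent.pair_iff]
    intro a b hab
    have ha : a = 0 := by
      have := LinearMap.congr_fun hab t
      simpa [hNt, ht] using this
    subst ha
    refine ⟨rfl, ?_⟩
    have := LinearMap.congr_fun hab x
    simpa [hNx] using this
  refine ⟨?_, N, hN, ⟨2, hsq⟩, hrange, hsq, hspan, ?_⟩
  · have := finrank_span_eq_card hli
    rw [Matrix.range_cons, Matrix.range_cons, Matrix.range_empty, Set.union_empty,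
      Set.singleton_union] at this
    rw [hspan, this, Fintype.card_fin]
  · rintro A hA ⟨m, hm⟩
    obtain ⟨c, d, rfl⟩ := hdec A hA
    -- Since `N t = 0`, `t` is an eigenvector with eigenvalue `c`, which nilpotency forces to
    -- vanish.
    have hpow : ∀ m : ℕ, ((c • LinearMap.id + d • N : Module.End ℂ V) ^ m) t = c ^ m • t := by
      intro m
      induction m with
      | zero => simp
      | succ m ih =>
        rw [pow_succ, Module.End.mul_apply]
        simp [hNt, ih, smul_smul, pow_succ, mul_comm]
    have hc : c ^ m = 0 := by
      have := hpow m
      rw [hm, LinearMap.zero_apply, eq_comm, smul_eq_zero] at this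
      exact this.resolve_right ht
    exact ⟨d, by rw [eq_zero_of_pow_eq_zero hc, zero_smul, zero_add]⟩
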